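/- Let $\varepsilon\in(0,1/2)$ be a constant, let $\beta=\beta(n)\in(0,1)$ be arbitrary, and put $\gamma=\gamma(n)=n^{\varepsilon}$. Then there is an algorithm running in time $\exp(O(n^{2\varepsilon}))$ that solves the decision problem $\mathrm{hCLWE}_{\beta,\gamma}$ with high probability. Here $\rho_s(x)=\exp(-\pi\|x/s\|^2)$ and $\rho=\rho_1$; the standard Gaussian $D_{\mathbb R^n}$ has density $\rho$ on $\mathbb R^n$; and for a unit vector $w\in\mathbb R^n$ the homogeneous CLWE distribution $H_{w,\beta,\gamma}$ has density at $y\in\mathbb R^n$ proportional to $\rho(y)\sum_{k\in\mathbb Z}\rho_\beta(k-\gamma\langle y,w\rangle)$. The problem $\mathrm{hCLWE}_{\beta,\gamma}$ is, given $n$ and independent samples from an unknown distribution on $\mathbb R^n$, to distinguish the case of $H_{w,\beta(n),\gamma(n)}$ for a uniformly random unit vector $w$, fixed for all samples (answer YES), from the case of $D_{\mathbb R^n}$ (answer NO). An algorithm is a single finite program, the same for all $n$, for a real RAM with unit-cost arithmetic operations ($+,-,\times,/$), comparisons and indirect addressing, with rational constants and the real constant $\varepsilon$; it is deterministic, is given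 $n$, and reads the coordinates of the samples one by one at unit cost each. Precisely, there are such a program and a constant $C$ such that: 1. for every $n\ge1$ and every sequence of samples in $\mathbb R^n$ the program halts with an answer after at most $\exp(C n^{2\varepsilon})$ steps; 2. as $n\to\infty$, the probability (over $w$ and the samples) that it answers YES on samples from $H_{w,\beta(n),\gamma(n)}$ tends to $1$, and the probability that it answers NO on samples from $D_{\mathbb R^n}$ tends to $1$. -/

import Mathlib

open MeasureTheory Filter
open scoped Topology ENNReal

noncomputable section

namespace HCLWE

/-! ### The distributions -/

/-- Euclidean space `ℝⁿ`. -/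
abbrev E (n : ℕ) : Type := EuclideanSpace ℝ (Fin n)

/-- The Gaussian function `ρ_s(x) = exp (-π ‖x / s‖²)` on a real inner product space. -/
def rho {V : Type*} [NormedAddCommGroup V] [NormedSpace ℝ V] (s : ℝ) (x : V) : ℝ :=
  Real.exp (-Real.pi * ‖s⁻¹ • x‖ ^ 2)

/-- The probability measure on `ℝⁿ` whose density is proportional to `f` (for `f` nonnegative and
measurable with finite, nonzero integral). -/
def ofDensity {n : ℕ} (f : E n → ℝ) : Measure (E n) :=
  (∫⁻ y, ENNReal.ofReal (f y))⁻¹ • (volume : Measure (E n)).withDensity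
    (fun y => ENNReal.ofReal (f y))

/-- The standard Gaussian `D_{ℝⁿ}`, of density `ρ = ρ_1` (so of covariance `I_n / (2π)`). -/
def stdGaussian (n : ℕ) : Measure (E n) := ofDensity (fun y => rho 1 y)

/-- The homogeneous CLWE distribution `H_{w,β,γ}`, of density at `y` proportional to
`ρ(y) * ∑_{k ∈ ℤ} ρ_β(k - γ ⟨y, w⟩)`. -/
def homCLWE {n : ℕ} (w : E n) (β γ : ℝ) : Measure (E n) :=
  ofDensity (fun y => rho 1 y * ∑' k : ℤ, rho β ((k : ℝ) - γ * inner ℝ y w))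

/-- The uniform probability measure on the unit sphere of `ℝⁿ`, `n ≥ 1`. -/
def uniformSphere (n : ℕ) : Measure (Metric.sphere (0 : E n) 1) :=
  ((volume : Measure (E n)).toSphere Set.univ)⁻¹ • (volume : Measure (E n)).toSphere

/-! ### The machine model: a real RAM with unit cost -/

/-- Instructions of a real RAM. It has index registers, holding natural numbers, and real cells,
holding real numbers; real cells can also be addressed indirectly through index registers.
There is a one-way read-only input stream of real numbers. Real constants written in a program
are rational. -/
inductive Instr : Type
  /-- index register `i` becomes the constant `a` -/
  | idxConst (i a : ℕ)
  /-- index register `i` becomes the sum of the index registers `j` and `k` -/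
  | idxAdd (i j k : ℕ)
  /-- index register `i` becomes the truncated difference of the index registers `j` and `k` -/
  | idxSub (i j k : ℕ)
  /-- real cell `i` becomes the rational constant `q` -/
  | realConst (i : ℕ) (q : ℚ)
  /-- real cell `i` becomes the value of index register `j` -/
  | realOfIdx (i j : ℕ)
  /-- real cell `i` becomes the sum of the real cells `j` and `k` -/
  | realAdd (i j k : ℕ)
  /-- real cell `i` becomes the difference of the real cells `j` and `k` -/
  | realSub (i j k : ℕ)
  /-- real cell `i` becomes the product of the real cells `j` and `k` -/
  | realMul (i j k : ℕ)
  /-- real cell `i` becomes the quotient of the real cells `j` and `k` -/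
  | realDiv (i j k : ℕ)
  /-- real cell `i` becomes the real cell whose address is in index register `j` -/
  | load (i j : ℕ)
  /-- the real cell whose address is in index register `i` becomes the real cell `j` -/
  | store (i j : ℕ)
  /-- the next number of the input stream is read into real cell `i` -/
  | read (i : ℕ)
  /-- jump to line `l` -/
  | jump (l : ℕ)
  /-- jump to line `l` if index register `i` is less than index register `j` -/
  | jumpIdxLt (i j l : ℕ)
  /-- jump to line `l` if real cell `i` is less than real cell `j` -/
  | jumpRealLt (i j l : ℕ)
  /-- halt with the answer `b` (`true` is YES, `false` is NO) -/
  | halt (b : Bool)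

/-- A program is a finite list of instructions. -/
abbrev Program : Type := List Instr

/-- A configuration of the machine: program counter, index registers, real cells, number of input
values read so far, and the answer, if the machine has halted. -/
structure Config : Type where
  pc : ℕ
  idx : ℕ → ℕ
  mem : ℕ → ℝ
  head : ℕ
  out : Option Bool

/-- Write `a` to index register `i` and go to the next line. -/
def Config.setIdx (c : Config) (i a : ℕ) : Config :=
  { c with pc := c.pc + 1, idx := Function.update c.idx i a }

/-- Write `x` to real cell `i` and go to the next line. -/
def Config.setMem (c : Config) (i : ℕ) (x : ℝ) : Config :=
  { c with pc := c.pc + 1, mem := Function.update c.mem i x }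

/-- Execution of one instruction on the input stream `x`. -/
def Instr.exec (x : ℕ → ℝ) (c : Config) : Instr → Config
  | .idxConst i a => c.setIdx i a
  | .idxAdd i j k => c.setIdx i (c.idx j + c.idx k)
  | .idxSub i j k => c.setIdx i (c.idx j - c.idx k)
  | .realConst i q => c.setMem i (q : ℝ)
  | .realOfIdx i j => c.setMem i (c.idx j : ℝ)
  | .realAdd i j k => c.setMem i (c.mem j + c.mem k)
  | .realSub i j k => c.setMem i (c.mem j - c.mem k)
  | .realMul i j k => c.setMem i (c.mem j * c.mem k)
  | .realDiv i j k => c.setMem i (c.mem j / c.mem k)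
  | .load i j => c.setMem i (c.mem (c.idx j))
  | .store i j => c.setMem (c.idx i) (c.mem j)
  | .read i => { c.setMem i (x c.head) with head := c.head + 1 }
  | .jump l => { c with pc := l }
  | .jumpIdxLt i j l => { c with pc := if c.idx i < c.idx j then l else c.pc + 1 }
  | .jumpRealLt i j l => { c with pc := if c.mem i < c.mem j then l else c.pc + 1 }
  | .halt b => { c with out := some b }

/-- One step of the program `P` on the input stream `x`. A machine that has halted, or whose
program counter has left the program, does not move any more (in the latter case it never gives an
answer). -/
def step (P : Program) (x : ℕ → ℝ) (c : Config) : Config :=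
  match c.out with
  | some _ => c
  | none =>
    match P[c.pc]? with
    | none => c
    | some I => I.exec x c

/-- The initial configuration in dimension `n`: index register `0` holds `n`, real cell `0` holds
the real constant `a` that is hard-wired into the algorithm, and all others hold `0`. -/
def initial (n : ℕ) (a : ℝ) : Config where
  pc := 0
  idx := Function.update (fun _ => 0) 0 n
  mem := Function.update (fun _ => 0) 0 a
  head := 0
  out := none

/-- The input stream made of the coordinates of the samples `ω 0, ω 1, …` in `ℝⁿ`, `n ≥ 1`, one
sample after the other. -/
def stream {n : ℕ} (ω : ℕ → E n) (p : ℕ) : ℝ :=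
  if h : 0 < n then ω (p / n) ⟨p % n, Nat.mod_lt p h⟩ else 0

/-- The configuration after `t` steps on the samples `ω`. -/
def run (P : Program) (a : ℝ) {n : ℕ} (ω : ℕ → E n) (t : ℕ) : Config :=
  (step P (stream ω))^[t] (initial n a)

/-- The program halts with answer `b` on the samples `ω`. -/
def Answers (P : Program) (a : ℝ) {n : ℕ} (ω : ℕ → E n) (b : Bool) : Prop :=
  ∃ t : ℕ, (run P a ω t).out = some b

/-- In every dimension `n ≥ 1` and on every sequence of samples, the program halts within `T n`
steps. -/
def RunsInTime (P : Program) (a : ℝ) (T : ℕ → ℝ) : Prop :=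
  ∀ n : ℕ, 1 ≤ n → ∀ ω : ℕ → E n,
    ∃ t : ℕ, (t : ℝ) ≤ T n ∧ ∃ b : Bool, (run P a ω t).out = some b

/-! ### The decision problem -/

/-- The probability that the program answers `b` on independent samples from `μ`. -/
def answerProb (P : Program) (a : ℝ) {n : ℕ} (μ : Measure (E n)) (b : Bool) : ℝ≥0∞ :=
  Measure.infinitePi (fun _ : ℕ => μ) {ω | Answers P a ω b}

/-- The probability that the program answers `b` when a hidden direction `w` is drawn uniformly from
the unit sphere and then, `w` being fixed, all samples are drawn from `H_{w,β,γ}`. -/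
def answerProbHomCLWE (P : Program) (a : ℝ) (n : ℕ) (β γ : ℝ) (b : Bool) : ℝ≥0∞ :=
  ∫⁻ w, answerProb P a (homCLWE (w : E n) β γ) b ∂(uniformSphere n)

/-- The program solves the average-case decision problem `hCLWE_{β,γ}`, where `β = β(n)` and
`γ = γ(n)`, with high probability: in both cases the probability of the correct answer, YES for
homogeneous CLWE and NO for the standard Gaussian, tends to `1` as `n → ∞`. -/
def SolvesHCLWE (P : Program) (a : ℝ) (β γ : ℕ → ℝ) : Prop :=
  Tendsto (fun n => answerProbHomCLWE P a n (β n) (γ n) true) atTop (𝓝 1) ∧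
    Tendsto (fun n => answerProb P a (stdGaussian n) false) atTop (𝓝 1)

end HCLWE

end

/-! The squared norm of one sample already separates the two cases. By Poisson summation the
periodic factor of the homogeneous CLWE density is `β ∑ₘ exp(-πβ²m²) exp(2πimγ⟨y,w⟩)`. Integrating
each mode against `exp(-πb‖y‖²)` gives `integral_tilted`, hence the exact moment generating function
of `π‖y‖²`: the Gaussian value `(1-u)^(-n/2)` times a quotient of theta values in which `w` no
longer occurs (`integral_exp_homCLWE`). For `0 ≤ u ≤ 1/2` this quotient is at most `exp(-gap γ *
u)`, where `gap γ` is of order `exp(-πγ²)` whatever `β` is (`theta_div_le`). So squared norms are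
smaller than Gaussian ones by an amount that `exp(O(n^(2ε)))` samples detect.

With `L = rounds ε n`, between `8n^(2ε)` and `32n^(2ε)`, and `M = 2^L`, the program averages over
`M³ = 8^L` samples and answers YES if the sum of squares lies below the Gaussian mean by a relative
margin of about `1/M`. Chernoff bounds control both errors (`measure_accepts_le`,
`measure_not_accepts_le`); the second needs `gap γ * M ≥ 2n`, which holds eventually because `2^8 >
e^π` (`eventually_le_gap`). The number π is replaced by a Leibniz sum accurate enough to cost only
half the margin. -/

noncomputable section

namespace HCLWE

/-! ### Execution of programs on registers given by lists -/

/-- The registers that hold the entries of a list, and `0` after its end. -/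
def regs {α : Type} [Zero α] (l : List α) (k : ℕ) : α := l.getD k 0

/-- With list literals as memory, `simp` can execute straight-line code symbolically. The bound on
`i` matters: `List.set` past the end does nothing. -/
theorem update_regs {α : Type} [Zero α] (l : List α) (i : ℕ) (v : α) (h : i < l.length) :
    Function.update (regs l) i v = regs (l.set i v) := by
  funext k
  unfold regs
  rcases eq_or_ne k i with rfl | hk
  · simp [h]
  · simp [Function.update_of_ne hk, List.getElem?_set_ne hk.symm]

/-- A running configuration whose registers and cells are given by lists. -/
def listConfig (pc : ℕ) (I : List ℕ) (m : List ℝ) (head : ℕ) : Config :=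
  ⟨pc, regs I, regs m, head, none⟩

section exec

variable (x : ℕ → ℝ) (pc : ℕ) (I : List ℕ) (m : List ℝ) (hd : ℕ)

theorem step_listConfig (P : Program) :
    step P x (listConfig pc I m hd) =
      (P[pc]?).elim (listConfig pc I m hd) (fun J => J.exec x (listConfig pc I m hd)) := by
  cases h : P[pc]? <;> simp [step, listConfig, h]

theorem exec_idxConst (i a : ℕ) (h : i < I.length) :
    Instr.exec x (listConfig pc I m hd) (.idxConst i a) =
      listConfig (pc + 1) (I.set i a) m hd := by
  simp [Instr.exec, listConfig, Config.setIdx, update_regs _ _ _ h]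

theorem exec_idxAdd (i j k : ℕ) (h : i < I.length) :
    Instr.exec x (listConfig pc I m hd) (.idxAdd i j k) =
      listConfig (pc + 1) (I.set i (I.getD j 0 + I.getD k 0)) m hd := by
  simp [Instr.exec, listConfig, Config.setIdx, update_regs _ _ _ h, regs]

theorem exec_realConst (i : ℕ) (q : ℚ) (h : i < m.length) :
    Instr.exec x (listConfig pc I m hd) (.realConst i q) =
      listConfig (pc + 1) I (m.set i q) hd := by
  simp [Instr.exec, listConfig, Config.setMem, update_regs _ _ _ h]

theorem exec_realOfIdx (i j : ℕ) (h : i < m.length) :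
    Instr.exec x (listConfig pc I m hd) (.realOfIdx i j) =
      listConfig (pc + 1) I (m.set i (I.getD j 0 : ℕ)) hd := by
  simp [Instr.exec, listConfig, Config.setMem, update_regs _ _ _ h, regs]

theorem exec_realAdd (i j k : ℕ) (h : i < m.length) :
    Instr.exec x (listConfig pc I m hd) (.realAdd i j k) =
      listConfig (pc + 1) I (m.set i (m.getD j 0 + m.getD k 0)) hd := by
  simp [Instr.exec, listConfig, Config.setMem, update_regs _ _ _ h, regs]

theorem exec_realSub (i j k : ℕ) (h : i < m.length) :
    Instr.exec x (listConfig pc I m hd) (.realSub i j k) =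
      listConfig (pc + 1) I (m.set i (m.getD j 0 - m.getD k 0)) hd := by
  simp [Instr.exec, listConfig, Config.setMem, update_regs _ _ _ h, regs]

theorem exec_realMul (i j k : ℕ) (h : i < m.length) :
    Instr.exec x (listConfig pc I m hd) (.realMul i j k) =
      listConfig (pc + 1) I (m.set i (m.getD j 0 * m.getD k 0)) hd := by
  simp [Instr.exec, listConfig, Config.setMem, update_regs _ _ _ h, regs]

theorem exec_realDiv (i j k : ℕ) (h : i < m.length) :
    Instr.exec x (listConfig pc I m hd) (.realDiv i j k) =
      listConfig (pc + 1) I (m.set i (m.getD j 0 / m.getD k 0)) hd := by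
  simp [Instr.exec, listConfig, Config.setMem, update_regs _ _ _ h, regs]

theorem exec_read (i : ℕ) (h : i < m.length) :
    Instr.exec x (listConfig pc I m hd) (.read i) =
      listConfig (pc + 1) I (m.set i (x hd)) (hd + 1) := by
  simp [Instr.exec, listConfig, Config.setMem, update_regs _ _ _ h]

theorem exec_jump (l : ℕ) :
    Instr.exec x (listConfig pc I m hd) (.jump l) = listConfig l I m hd := rfl

theorem exec_jumpIdxLt (i j l : ℕ) :
    Instr.exec x (listConfig pc I m hd) (.jumpIdxLt i j l) =
      listConfig (if I.getD i 0 < I.getD j 0 then l else pc + 1) I m hd := rfl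

theorem exec_jumpRealLt (i j l : ℕ) :
    Instr.exec x (listConfig pc I m hd) (.jumpRealLt i j l) =
      listConfig (if m.getD i 0 < m.getD j 0 then l else pc + 1) I m hd := rfl

theorem exec_halt_out (b : Bool) :
    (Instr.exec x (listConfig pc I m hd) (.halt b)).out = some b := rfl

end exec

/-! ### The program -/

/-- The program estimates the expected squared norm of a sample, and compares it with the value
`n / (2π)` it has for the standard Gaussian, where `π` is computed by the Leibniz series. The first
two loops compute a power of two of order `n ^ (2ε)`, the third one an accuracy `1 / M` and a
number `T` of coordinates to be read, and the fourth one reads these coordinates. -/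
def prog : Program :=
  [.idxConst 1 1,
   .idxConst 2 16,
   .idxConst 3 1,
   .realConst 1 1,
   .realAdd 2 0 0,
   .jumpIdxLt 1 0 7,
   .jump 10,
   .idxAdd 1 1 1,
   .realAdd 3 3 2,
   .jump 5,
   .jumpRealLt 1 3 12,
   .jump 15,
   .realSub 3 3 1,
   .idxAdd 2 2 2,
   .jump 10,
   .idxAdd 5 4 0,
   .realConst 4 1,
   .jumpIdxLt 4 2 19,
   .jump 25,
   .idxAdd 5 5 5,
   .idxAdd 5 5 5,
   .idxAdd 5 5 5,
   .realAdd 4 4 4,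
   .idxAdd 4 4 3,
   .jump 17,
   .realConst 7 1,
   .realConst 8 4,
   .realConst 9 2,
   .jumpIdxLt 6 5 30,
   .jump 39,
   .read 10,
   .realMul 10 10 10,
   .realAdd 5 5 10,
   .realDiv 11 8 7,
   .realAdd 6 6 11,
   .realAdd 7 7 9,
   .realSub 8 12 8,
   .idxAdd 6 6 3,
   .jump 28,
   .realOfIdx 13 5,
   .realMul 14 6 5,
   .realMul 14 14 9,
   .realMul 14 14 4,
   .realSub 15 4 1,
   .realMul 15 15 13,
   .jumpRealLt 14 15 47,
   .halt false,
   .halt true]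

theorem initial_eq_listConfig (n : ℕ) (a : ℝ) :
    initial n a = listConfig 0 [n, 0, 0, 0, 0, 0, 0]
      [a, 0, 0, 0, 0, 0, 0, 0, 0, 0, 0, 0, 0, 0, 0, 0] 0 := by
  have h1 : Function.update (fun _ => 0) 0 n = regs [n, 0, 0, 0, 0, 0, 0] := by
    rw [show (fun _ : ℕ => 0) = regs [0, 0, 0, 0, 0, 0, 0] from ?_, update_regs _ _ _ (by simp)]
    · rfl
    · funext k; unfold regs; rcases k with _ | _ | _ | _ | _ | _ | _ | k <;> rfl
  have h2 : Function.update (fun _ => 0) 0 a =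
      regs [a, 0, 0, 0, 0, 0, 0, 0, 0, 0, 0, 0, 0, 0, 0, 0] := by
    rw [show (fun _ : ℕ => (0 : ℝ)) =
      regs [0, 0, 0, 0, 0, 0, 0, 0, 0, 0, 0, 0, 0, 0, 0, 0] from ?_, update_regs _ _ _ (by simp)]
    · rfl
    · funext k; unfold regs
      rcases k with _ | _ | _ | _ | _ | _ | _ | _ | _ | _ | _ | _ | _ | _ | _ | _ | k <;> rfl
  unfold initial listConfig
  rw [h1, h2]

/-! ### Single passes through the loops -/

section loops

variable (x : ℕ → ℝ)

theorem run_init (n : ℕ) (a : ℝ) :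
    (step prog x)^[5] (initial n a) = listConfig 5 [n, 1, 16, 1, 0, 0, 0]
      [a, 1, a + a, 0, 0, 0, 0, 0, 0, 0, 0, 0, 0, 0, 0, 0] 0 := by
  rw [initial_eq_listConfig]
  simp [Function.iterate_succ_apply, step_listConfig, prog, exec_idxConst,
    exec_realConst, exec_realAdd]

/-- Powers with exponent `2ε` are not machine operations. Adding `2a` at each doubling leaves `2a *
clog 2 n` in cell 3, the base-2 logarithm of `n^(2a)` up to rounding of the logarithm of `n`. -/
theorem run_doubling_body (n p : ℕ) (a r : ℝ) (h : p < n) :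
    (step prog x)^[4] (listConfig 5 [n, p, 16, 1, 0, 0, 0]
      [a, 1, a + a, r, 0, 0, 0, 0, 0, 0, 0, 0, 0, 0, 0, 0] 0) =
    listConfig 5 [n, p + p, 16, 1, 0, 0, 0]
      [a, 1, a + a, r + (a + a), 0, 0, 0, 0, 0, 0, 0, 0, 0, 0, 0, 0] 0 := by
  simp [Function.iterate_succ_apply, step_listConfig, prog, exec_jumpIdxLt,
    exec_idxAdd, exec_realAdd, exec_jump, h]

theorem run_doubling_exit (n p : ℕ) (a r : ℝ) (h : ¬ p < n) :
    (step prog x)^[2] (listConfig 5 [n, p, 16, 1, 0, 0, 0]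
      [a, 1, a + a, r, 0, 0, 0, 0, 0, 0, 0, 0, 0, 0, 0, 0] 0) =
    listConfig 10 [n, p, 16, 1, 0, 0, 0]
      [a, 1, a + a, r, 0, 0, 0, 0, 0, 0, 0, 0, 0, 0, 0, 0] 0 := by
  simp [Function.iterate_succ_apply, step_listConfig, prog, exec_jumpIdxLt,
    exec_jump, h]

theorem run_power_body (n p L : ℕ) (a r : ℝ) (h : 1 < r) :
    (step prog x)^[4] (listConfig 10 [n, p, L, 1, 0, 0, 0]
      [a, 1, a + a, r, 0, 0, 0, 0, 0, 0, 0, 0, 0, 0, 0, 0] 0) =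
    listConfig 10 [n, p, L + L, 1, 0, 0, 0]
      [a, 1, a + a, r - 1, 0, 0, 0, 0, 0, 0, 0, 0, 0, 0, 0, 0] 0 := by
  simp [Function.iterate_succ_apply, step_listConfig, prog, exec_jumpRealLt,
    exec_idxAdd, exec_realSub, exec_jump, h]

theorem run_power_exit (n p L : ℕ) (a r : ℝ) (h : ¬ 1 < r) :
    (step prog x)^[4] (listConfig 10 [n, p, L, 1, 0, 0, 0]
      [a, 1, a + a, r, 0, 0, 0, 0, 0, 0, 0, 0, 0, 0, 0, 0] 0) =
    listConfig 17 [n, p, L, 1, 0, n, 0]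
      [a, 1, a + a, r, 1, 0, 0, 0, 0, 0, 0, 0, 0, 0, 0, 0] 0 := by
  simp [Function.iterate_succ_apply, step_listConfig, prog, exec_jumpRealLt,
    exec_idxAdd, exec_realConst, exec_jump, h]

/-- Three self-additions multiply `T` by 8 while `M` doubles, which keeps the number of samples
equal to `M³`. -/
theorem run_count_body (n p L c T : ℕ) (a r M : ℝ) (h : c < L) :
    (step prog x)^[7] (listConfig 17 [n, p, L, 1, c, T, 0]
      [a, 1, a + a, r, M, 0, 0, 0, 0, 0, 0, 0, 0, 0, 0, 0] 0) =
    listConfig 17 [n, p, L, 1, c + 1, T + T + (T + T) + (T + T + (T + T)), 0]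
      [a, 1, a + a, r, M + M, 0, 0, 0, 0, 0, 0, 0, 0, 0, 0, 0] 0 := by
  simp [Function.iterate_succ_apply, step_listConfig, prog, exec_jumpIdxLt,
    exec_idxAdd, exec_realAdd, exec_jump, h]

theorem run_count_exit (n p L c T : ℕ) (a r M : ℝ) (h : ¬ c < L) :
    (step prog x)^[5] (listConfig 17 [n, p, L, 1, c, T, 0]
      [a, 1, a + a, r, M, 0, 0, 0, 0, 0, 0, 0, 0, 0, 0, 0] 0) =
    listConfig 28 [n, p, L, 1, c, T, 0]
      [a, 1, a + a, r, M, 0, 0, 1, 4, 2, 0, 0, 0, 0, 0, 0] 0 := by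
  simp [Function.iterate_succ_apply, step_listConfig, prog, exec_jumpIdxLt,
    exec_realConst, exec_jump, h]

/-- Cell 12 is never written, so subtracting from it flips the sign of the Leibniz numerator `s`. -/
theorem run_read_body (n p L c T q hd : ℕ) (a r M S A o s y z : ℝ) (h : q < T) :
    (step prog x)^[10] (listConfig 28 [n, p, L, 1, c, T, q]
      [a, 1, a + a, r, M, S, A, o, s, 2, y, z, 0, 0, 0, 0] hd) =
    listConfig 28 [n, p, L, 1, c, T, q + 1]
      [a, 1, a + a, r, M, S + x hd * x hd, A + s / o, o + 2, 0 - s, 2, x hd * x hd, s / o,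
        0, 0, 0, 0] (hd + 1) := by
  simp [Function.iterate_succ_apply, step_listConfig, prog, exec_jumpIdxLt,
    exec_idxAdd, exec_realAdd, exec_realSub, exec_realMul, exec_realDiv, exec_read, exec_jump, h]

theorem run_decide (n p L c T q hd : ℕ) (a r M S A o s y z : ℝ) (h : ¬ q < T) :
    ((step prog x)^[10] (listConfig 28 [n, p, L, 1, c, T, q]
      [a, 1, a + a, r, M, S, A, o, s, 2, y, z, 0, 0, 0, 0] hd)).out =
    some (decide (A * S * 2 * M < (M - 1) * T)) := by
  by_cases hlt : A * S * 2 * M < (M - 1) * T <;>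
  simp [Function.iterate_succ_apply, step_listConfig, prog, exec_jumpIdxLt,
    exec_realSub, exec_realMul, exec_jump, h,
    exec_realOfIdx, exec_jumpRealLt, hlt, exec_halt_out]

/-! ### Loop invariants -/

theorem run_doubling (n : ℕ) (a : ℝ) (i : ℕ) (h : i ≤ Nat.clog 2 n) :
    (step prog x)^[4 * i] (listConfig 5 [n, 1, 16, 1, 0, 0, 0]
      [a, 1, a + a, 0, 0, 0, 0, 0, 0, 0, 0, 0, 0, 0, 0, 0] 0) =
    listConfig 5 [n, 2 ^ i, 16, 1, 0, 0, 0]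
      [a, 1, a + a, i * (a + a), 0, 0, 0, 0, 0, 0, 0, 0, 0, 0, 0, 0] 0 := by
  induction i with
  | zero => simp
  | succ i ih =>
    have hlt : 2 ^ i < n := (Nat.lt_clog_iff_pow_lt one_lt_two).1 h
    rw [mul_add, mul_one, add_comm, Function.iterate_add_apply, ih (by omega),
      run_doubling_body x _ _ _ _ hlt]
    congr 3
    · ring
    · push_cast; simp [add_mul]

theorem run_power (n p : ℕ) (a r : ℝ) (i : ℕ) (h : i ≤ ⌈r⌉₊ - 1) :
    (step prog x)^[4 * i] (listConfig 10 [n, p, 16, 1, 0, 0, 0]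
      [a, 1, a + a, r, 0, 0, 0, 0, 0, 0, 0, 0, 0, 0, 0, 0] 0) =
    listConfig 10 [n, p, 16 * 2 ^ i, 1, 0, 0, 0]
      [a, 1, a + a, r - i, 0, 0, 0, 0, 0, 0, 0, 0, 0, 0, 0, 0] 0 := by
  induction i with
  | zero => simp
  | succ i ih =>
    have hlt : ((i + 1 : ℕ) : ℝ) < r := Nat.lt_ceil.1 (by omega)
    push_cast at hlt
    rw [mul_add, mul_one, add_comm, Function.iterate_add_apply, ih (by omega),
      run_power_body x _ _ _ _ _ (by linarith)]
    congr 3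
    · simp only [List.cons.injEq, and_true]; ring
    · push_cast; simp [sub_sub]

theorem run_count (n p L : ℕ) (a r : ℝ) (i : ℕ) (h : i ≤ L) :
    (step prog x)^[7 * i] (listConfig 17 [n, p, L, 1, 0, n, 0]
      [a, 1, a + a, r, 1, 0, 0, 0, 0, 0, 0, 0, 0, 0, 0, 0] 0) =
    listConfig 17 [n, p, L, 1, i, n * 8 ^ i, 0]
      [a, 1, a + a, r, 2 ^ i, 0, 0, 0, 0, 0, 0, 0, 0, 0, 0, 0] 0 := by
  induction i with
  | zero => simp
  | succ i ih =>
    rw [mul_add, mul_one, add_comm, Function.iterate_add_apply, ih (by omega),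
      run_count_body x _ _ _ _ _ _ _ _ (by omega)]
    congr 3
    · simp only [List.cons.injEq, and_true, true_and]; ring
    · simp only [List.cons.injEq, and_true, true_and]; ring

/-- The partial sums of the Leibniz series for `π`. -/
def leibniz (k : ℕ) : ℝ := ∑ i ∈ Finset.range k, 4 * (-1) ^ i / (2 * i + 1)

/-- The scratch cells `y`, `z` are existential because they are zero before the first pass and only
later hold the last square and quotient. -/
theorem run_read (n p L c T : ℕ) (a r M : ℝ) (i : ℕ) (h : i ≤ T) :
    ∃ y z, (step prog x)^[10 * i] (listConfig 28 [n, p, L, 1, c, T, 0]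
      [a, 1, a + a, r, M, 0, 0, 1, 4, 2, 0, 0, 0, 0, 0, 0] 0) =
    listConfig 28 [n, p, L, 1, c, T, i]
      [a, 1, a + a, r, M, ∑ q ∈ Finset.range i, x q * x q, leibniz i, 2 * i + 1, 4 * (-1) ^ i,
        2, y, z, 0, 0, 0, 0] i := by
  induction i with
  | zero => exact ⟨0, 0, by simp [leibniz]⟩
  | succ i ih =>
    obtain ⟨y, z, ih⟩ := ih (by omega)
    refine ⟨x i * x i, 4 * (-1) ^ i / (2 * i + 1), ?_⟩
    rw [mul_add, mul_one, add_comm, Function.iterate_add_apply, ih,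
      run_read_body x _ _ _ _ _ _ _ _ _ _ _ _ _ _ _ _ (by omega)]
    congr 1
    simp only [List.cons.injEq, and_true, true_and, leibniz, Finset.sum_range_succ]
    push_cast
    refine ⟨by ring, by ring⟩

end loops

/-- The number of rounds of the third loop. -/
def rounds (a : ℝ) (n : ℕ) : ℕ := 16 * 2 ^ (⌈(Nat.clog 2 n : ℝ) * (a + a)⌉₊ - 1)

/-- The condition under which the program answers YES. -/
def Accepts (a : ℝ) {n : ℕ} (ω : ℕ → E n) : Prop :=
  leibniz (n * 8 ^ rounds a n) *
      (∑ q ∈ Finset.range (n * 8 ^ rounds a n), stream ω q * stream ω q) * 2 * 2 ^ rounds a n <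
    (2 ^ rounds a n - 1) * (n * 8 ^ rounds a n : ℕ)

open Classical in
theorem exists_run_out (a : ℝ) {n : ℕ} (hn : 1 ≤ n) (ω : ℕ → E n) :
    ∃ t ≤ 51 * (n * 8 ^ rounds a n), (run prog a ω t).out = some (decide (Accepts a ω)) := by
  set l := Nat.clog 2 n
  set j := ⌈(l : ℝ) * (a + a)⌉₊ - 1
  set L := 16 * 2 ^ j
  have hL : rounds a n = L := rfl
  set T := n * 8 ^ L
  obtain ⟨y, z, hD⟩ := run_read (stream ω) n (2 ^ l) L L T a (l * (a + a) - j) (2 ^ L) T le_rfl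
  have hp : ¬ 2 ^ l < n := not_lt.2 (Nat.le_pow_clog one_lt_two n)
  -- Truncated subtraction gives `j = 0` when the ceiling is 0, and the loop then exits at once, as
  -- it should.
  have hr : ¬ 1 < (l : ℝ) * (a + a) - j := by
    have h1 := Nat.le_ceil ((l : ℝ) * (a + a))
    have h2 : ⌈(l : ℝ) * (a + a)⌉₊ ≤ j + 1 := by omega
    have h3 : ((⌈(l : ℝ) * (a + a)⌉₊ : ℕ) : ℝ) ≤ j + 1 := by exact_mod_cast h2
    linarith
  refine ⟨10 + (10 * T + (5 + (7 * L + (4 + (4 * j + (2 + (4 * l + 5))))))), ?_, ?_⟩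
  -- The constants add up to 26, and each of `1`, `L`, `j`, `l` is at most `T`: 26 + 10 + 7 + 4 + 4
  -- = 51.
  · have h1 : l ≤ n := Nat.clog_le_of_le_pow (Nat.lt_two_pow_self).le
    have h2 : j < 2 ^ j := Nat.lt_two_pow_self
    have h3 : L < 8 ^ L := Nat.lt_pow_self (by norm_num)
    have h4 : n ≤ T := Nat.le_mul_of_pos_right _ (by positivity)
    have h5 : 8 ^ L ≤ T := Nat.le_mul_of_pos_left _ hn
    rw [hL]
    change _ ≤ 51 * T
    omega
  · unfold run
    rw [Function.iterate_add_apply, Function.iterate_add_apply _ (10 * T),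
      Function.iterate_add_apply _ 5, Function.iterate_add_apply _ (7 * L),
      Function.iterate_add_apply _ 4, Function.iterate_add_apply _ (4 * j),
      Function.iterate_add_apply _ 2, Function.iterate_add_apply _ (4 * l),
      run_init, run_doubling _ _ _ _ le_rfl, run_doubling_exit _ _ _ _ _ hp,
      run_power _ _ _ _ _ _ le_rfl, run_power_exit _ _ _ _ _ _ hr, run_count _ _ _ _ _ _ _ le_rfl,
      run_count_exit _ _ _ _ _ _ _ _ _ (lt_irrefl _), hD,
      run_decide _ _ _ _ _ _ _ _ _ _ _ _ _ _ _ _ _ (lt_irrefl _)]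
    rfl

theorem answers_true {a : ℝ} {n : ℕ} (hn : 1 ≤ n) {ω : ℕ → E n} (h : Accepts a ω) :
    Answers prog a ω true := by
  obtain ⟨t, -, ht⟩ := exists_run_out a hn ω
  exact ⟨t, by simpa [h] using ht⟩

theorem answers_false {a : ℝ} {n : ℕ} (hn : 1 ≤ n) {ω : ℕ → E n} (h : ¬ Accepts a ω) :
    Answers prog a ω false := by
  obtain ⟨t, -, ht⟩ := exists_run_out a hn ω
  exact ⟨t, by simpa [h] using ht⟩

/-! ### Measures given by densities -/

section ofDensity

variable {n : ℕ} {f : E n → ℝ}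

theorem lintegral_ofReal_density (hf : ∀ y, 0 ≤ f y) (hi : Integrable f) :
    ∫⁻ y, ENNReal.ofReal (f y) = ENNReal.ofReal (∫ y, f y) :=
  (ofReal_integral_eq_lintegral_ofReal hi (ae_of_all _ hf)).symm

theorem isProbabilityMeasure_ofDensity (hf : ∀ y, 0 ≤ f y) (hi : Integrable f)
    (hpos : 0 < ∫ y, f y) : IsProbabilityMeasure (ofDensity f) := by
  constructor
  rw [ofDensity, Measure.smul_apply, withDensity_apply _ MeasurableSet.univ, Measure.restrict_univ,
    lintegral_ofReal_density hf hi, smul_eq_mul]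
  exact ENNReal.inv_mul_cancel (by simpa using hpos) ENNReal.ofReal_ne_top

theorem integral_ofDensity (hf : ∀ y, 0 ≤ f y) (hi : Integrable f) (g : E n → ℝ) :
    ∫ y, g y ∂(ofDensity f) = (∫ y, f y)⁻¹ * ∫ y, f y * g y := by
  rw [ofDensity, integral_smul_measure, lintegral_ofReal_density hf hi,
    integral_withDensity_eq_integral_toReal_smul₀ hi.1.aemeasurable.ennreal_ofReal
      (ae_of_all _ fun _ => ENNReal.ofReal_lt_top)]
  simp [ENNReal.toReal_ofReal (integral_nonneg hf), ENNReal.toReal_ofReal (hf _)]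

theorem integrable_ofDensity (hf : ∀ y, 0 ≤ f y) (hi : Integrable f) (hpos : 0 < ∫ y, f y)
    {g : E n → ℝ} (hg : Integrable fun y => f y * g y) : Integrable g (ofDensity f) := by
  rw [ofDensity, lintegral_ofReal_density hf hi]
  refine Integrable.smul_measure ?_ (ENNReal.inv_ne_top.2 (by simpa using hpos))
  rw [integrable_withDensity_iff_integrable_smul₀' hi.1.aemeasurable.ennreal_ofReal
      (ae_of_all _ fun _ => ENNReal.ofReal_lt_top)]
  simpa [ENNReal.toReal_ofReal (hf _)] using hg

end ofDensity

/-! ### Gaussian integrals -/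

theorem summable_exp_neg_mul_int_sq {a : ℝ} (ha : 0 < a) :
    Summable fun m : ℤ => Real.exp (-a * (m : ℝ) ^ 2) := by
  refine (summable_pow_mul_jacobiTheta₂_term_bound 0 (div_pos ha Real.pi_pos) 0).congr fun m => ?_
  rw [pow_zero, one_mul]
  congr 1
  field_simp
  simp

/-- The theta series that normalizes tilted homogeneous CLWE densities. -/
def theta (a : ℝ) : ℝ := ∑' m : ℤ, Real.exp (-a * (m : ℝ) ^ 2)

theorem theta_pos {a : ℝ} (ha : 0 < a) : 0 < theta a :=
  (summable_exp_neg_mul_int_sq ha).tsum_pos (fun _ => (Real.exp_pos _).le) 0 (Real.exp_pos _)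

theorem theta_antitone {a b : ℝ} (ha : 0 < a) (h : a ≤ b) : theta b ≤ theta a :=
  (summable_exp_neg_mul_int_sq (ha.trans_le h)).tsum_le_tsum
    (fun m => by gcongr) (summable_exp_neg_mul_int_sq ha)

/-- All termwise differences are nonnegative, so the total drop is at least that of the term `m =
1`. -/
theorem theta_add_le {a c : ℝ} (ha : 0 < a) (hc : 0 ≤ c) :
    theta (a + c) ≤ theta a - Real.exp (-a) * (1 - Real.exp (-c)) := by
  have h1 := summable_exp_neg_mul_int_sq ha
  have h2 := summable_exp_neg_mul_int_sq (add_pos_of_pos_of_nonneg ha hc)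
  have h3 := (h1.sub h2).le_tsum (1 : ℤ) (fun m _ => sub_nonneg.2 (by gcongr; linarith))
  rw [h1.tsum_sub h2] at h3
  have h4 : Real.exp (-(a + c)) = Real.exp (-a) * Real.exp (-c) := by
    rw [← Real.exp_add]; ring_nf
  simp only [Int.cast_one, one_pow, mul_one, h4] at h3
  unfold theta
  linarith

theorem integral_exp_neg_mul_sq_norm (n : ℕ) {b : ℝ} (hb : 0 < b) :
    ∫ y : E n, Real.exp (-(Real.pi * b) * ‖y‖ ^ 2) = (b⁻¹) ^ ((n : ℝ) / 2) := by
  rw [GaussianFourier.integral_rexp_neg_mul_sq_norm (by positivity)]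
  simp only [finrank_euclideanSpace, Fintype.card_fin]
  congr 1
  field_simp

/-- Poisson summation, which turns the periodic comb of Gaussians into characters. -/
theorem tsum_rho_sub {β : ℝ} (hβ : 0 < β) (t : ℝ) :
    ((∑' k : ℤ, rho β ((k : ℝ) - t) : ℝ) : ℂ) =
      β * ∑' m : ℤ, Complex.exp (-Real.pi * (β : ℂ) ^ 2 * m ^ 2 +
        2 * Real.pi * (Complex.I * t) * m) := by
  have h := Complex.tsum_exp_neg_quadratic (a := (β : ℂ) ^ 2)
    (by rw [← Complex.ofReal_pow, Complex.ofReal_re]; positivity) (Complex.I * t)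
  have h2 : ((β : ℂ) ^ 2) ^ (1 / 2 : ℂ) = β := by
    rw [← Complex.ofReal_pow, show (1 / 2 : ℂ) = ((1 / 2 : ℝ) : ℂ) by push_cast; rfl,
      ← Complex.ofReal_cpow (by positivity), ← Real.sqrt_eq_rpow, Real.sqrt_sq hβ.le]
  have hβ' : (β : ℂ) ≠ 0 := by exact_mod_cast hβ.ne'
  rw [h, h2, Complex.ofReal_tsum]
  rw [← mul_assoc, mul_one_div_cancel hβ', one_mul]
  congr 1
  funext k
  rw [rho, norm_smul, mul_pow, Real.norm_eq_abs, Real.norm_eq_abs, sq_abs, sq_abs]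
  push_cast
  congr 1
  rw [← mul_assoc Complex.I, Complex.I_mul_I]
  field_simp
  ring

variable {n : ℕ}

/-- The homogeneous CLWE density, with the factor `ρ(y)` replaced by `exp (-π b ‖y‖²)`. -/
def tilted (w : E n) (β γ b : ℝ) (y : E n) : ℝ :=
  Real.exp (-(Real.pi * b) * ‖y‖ ^ 2) * ∑' k : ℤ, rho β ((k : ℝ) - γ * inner ℝ y w)

theorem tilted_nonneg (w : E n) (β γ b : ℝ) (y : E n) : 0 ≤ tilted w β γ b y :=
  mul_nonneg (Real.exp_pos _).le (tsum_nonneg fun _ => (Real.exp_pos _).le)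

theorem integral_tilted {w : E n} (hw : ‖w‖ = 1) {β b : ℝ} (γ : ℝ) (hβ : 0 < β) (hb : 0 < b) :
    ∫ y, tilted w β γ b y =
      β * (b⁻¹) ^ ((n : ℝ) / 2) * theta (Real.pi * (β ^ 2 + γ ^ 2 / b)) := by
  have hpb : 0 < ((Real.pi * b : ℝ) : ℂ).re := by rw [Complex.ofReal_re]; positivity
  set F : ℤ → E n → ℂ := fun m y => (Real.exp (-(Real.pi * β ^ 2) * (m : ℝ) ^ 2) : ℂ) *
    Complex.exp (-((Real.pi * b : ℝ) : ℂ) * (‖y‖ : ℂ) ^ 2 +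
      (2 * Real.pi * Complex.I * m * γ) * (inner ℝ w y : ℝ)) with hF
  have hpt (y : E n) : ((tilted w β γ b y : ℝ) : ℂ) = β * ∑' m, F m y := by
    rw [tilted, Complex.ofReal_mul, tsum_rho_sub hβ, mul_left_comm, ← tsum_mul_left]
    congr 2
    funext m
    simp only [hF]
    push_cast
    rw [← Complex.exp_add, ← Complex.exp_add, real_inner_comm]
    congr 1
    ring
  have hint (m : ℤ) : Integrable (F m) :=
    (GaussianFourier.integrable_cexp_neg_mul_sq_norm_add hpb _ _).const_mul _
  have hnorm (m : ℤ) (y : E n) : ‖F m y‖ = Real.exp (-(Real.pi * β ^ 2) * (m : ℝ) ^ 2) *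
      Real.exp (-(Real.pi * b) * ‖y‖ ^ 2) := by
    have : (-((Real.pi * b : ℝ) : ℂ) * (‖y‖ : ℂ) ^ 2 +
      (2 * Real.pi * Complex.I * m * γ) * (inner ℝ w y : ℝ)) =
      ((-(Real.pi * b) * ‖y‖ ^ 2 : ℝ) : ℂ) +
        ((2 * Real.pi * m * γ * inner ℝ w y : ℝ) : ℂ) * Complex.I := by
      push_cast; ring
    simp only [hF]
    rw [norm_mul, this, Complex.norm_exp, Complex.norm_real, Real.norm_of_nonneg (Real.exp_pos _).le,
      Complex.add_re, Complex.ofReal_re, Complex.re_ofReal_mul, Complex.I_re, mul_zero, add_zero]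
  -- The characters have modulus one, so `exp(-πβ²m²)` makes the norms summable and sum and integral
  -- can be exchanged.
  have hsum : Summable fun m => ∫ y, ‖F m y‖ := by
    simp only [hnorm, integral_const_mul]
    exact (summable_exp_neg_mul_int_sq (by positivity)).mul_right _
  have hval (m : ℤ) : ∫ y, F m y = (((b⁻¹) ^ ((n : ℝ) / 2) *
      Real.exp (-(Real.pi * (β ^ 2 + γ ^ 2 / b)) * (m : ℝ) ^ 2) : ℝ) : ℂ) := by
    simp only [hF]
    rw [integral_const_mul, GaussianFourier.integral_cexp_neg_mul_sq_norm_add hpb, hw]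
    have e1 : (Real.pi : ℂ) / ((Real.pi * b : ℝ) : ℂ) = ((b⁻¹ : ℝ) : ℂ) := by
      rw [← Complex.ofReal_div]; congr 1; field_simp
    have e2 : (Module.finrank ℝ (E n) : ℂ) / 2 = ((n / 2 : ℝ) : ℂ) := by simp
    rw [e1, e2, ← Complex.ofReal_cpow (by positivity), mul_left_comm, Complex.ofReal_mul]
    push_cast
    rw [← Complex.exp_add]
    congr 1
    have hb' : (b : ℂ) ≠ 0 := by exact_mod_cast hb.ne'
    have hpi : (Real.pi : ℂ) ≠ 0 := by exact_mod_cast Real.pi_ne_zero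
    have hI : Complex.I ^ 2 = -1 := Complex.I_sq
    field_simp
    rw [hI]
    congr 1
    field_simp
    ring
  have key : ((∫ y, tilted w β γ b y : ℝ) : ℂ) =
      ((β * ∑' m : ℤ, (b⁻¹) ^ ((n : ℝ) / 2) *
        Real.exp (-(Real.pi * (β ^ 2 + γ ^ 2 / b)) * (m : ℝ) ^ 2) : ℝ) : ℂ) := by
    rw [← integral_complex_ofReal]
    simp only [hpt, integral_const_mul]
    rw [← (hasSum_integral_of_summable_integral_norm hint hsum).tsum_eq, Complex.ofReal_mul,
      Complex.ofReal_tsum]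
    simp only [hval]
  rw [Complex.ofReal_inj.1 key, tsum_mul_left, theta, mul_assoc]

theorem integral_tilted_pos {w : E n} (hw : ‖w‖ = 1) {β b : ℝ} (γ : ℝ) (hβ : 0 < β) (hb : 0 < b) :
    0 < ∫ y, tilted w β γ b y := by
  rw [integral_tilted hw γ hβ hb]
  have := theta_pos (a := Real.pi * (β ^ 2 + γ ^ 2 / b)) (by positivity)
  positivity

/-- A function that is not integrable has Bochner integral 0, so the nonzero value already computed
forces integrability. -/
theorem integrable_tilted {w : E n} (hw : ‖w‖ = 1) {β b : ℝ} (γ : ℝ) (hβ : 0 < β) (hb : 0 < b) :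
    Integrable (tilted w β γ b) :=
  .of_integral_ne_zero (integral_tilted_pos hw γ hβ hb).ne'

/-! ### The moment generating function of the squared norm -/

theorem rho_one (y : E n) : rho 1 y = Real.exp (-(Real.pi * 1) * ‖y‖ ^ 2) := by
  simp [rho]

theorem homCLWE_eq (w : E n) (β γ : ℝ) : homCLWE w β γ = ofDensity (tilted w β γ 1) := by
  simp only [homCLWE, rho_one]; rfl

theorem tilted_mul_exp (w : E n) (β γ u : ℝ) (y : E n) :
    tilted w β γ 1 y * Real.exp (Real.pi * u * ‖y‖ ^ 2) = tilted w β γ (1 - u) y := by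
  rw [tilted, tilted, mul_right_comm, ← Real.exp_add]
  congr 2
  ring

theorem isProbabilityMeasure_homCLWE {w : E n} (hw : ‖w‖ = 1) {β : ℝ} (γ : ℝ) (hβ : 0 < β) :
    IsProbabilityMeasure (homCLWE w β γ) := by
  rw [homCLWE_eq]
  exact isProbabilityMeasure_ofDensity (tilted_nonneg w β γ 1)
    (integrable_tilted hw γ hβ one_pos) (integral_tilted_pos hw γ hβ one_pos)

theorem integrable_exp_homCLWE {w : E n} (hw : ‖w‖ = 1) {β u : ℝ} (γ : ℝ) (hβ : 0 < β)
    (hu : u < 1) :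
    Integrable (fun y => Real.exp (Real.pi * u * ‖y‖ ^ 2)) (homCLWE w β γ) := by
  rw [homCLWE_eq]
  refine integrable_ofDensity (tilted_nonneg w β γ 1)
    (integrable_tilted hw γ hβ one_pos) (integral_tilted_pos hw γ hβ one_pos) ?_
  simp only [tilted_mul_exp]
  exact integrable_tilted hw γ hβ (by linarith)

/-- The exponential weight only changes the Gaussian parameter from `1` to `1 - u`; the result is a
quotient of two normalizing integrals. -/
theorem integral_exp_homCLWE {w : E n} (hw : ‖w‖ = 1) {β u : ℝ} (γ : ℝ) (hβ : 0 < β)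
    (hu : u < 1) :
    ∫ y, Real.exp (Real.pi * u * ‖y‖ ^ 2) ∂(homCLWE w β γ) =
      ((1 - u)⁻¹) ^ ((n : ℝ) / 2) * (theta (Real.pi * (β ^ 2 + γ ^ 2 / (1 - u))) /
        theta (Real.pi * (β ^ 2 + γ ^ 2))) := by
  rw [homCLWE_eq, integral_ofDensity (tilted_nonneg w β γ 1) (integrable_tilted hw γ hβ one_pos)]
  simp only [tilted_mul_exp]
  rw [integral_tilted hw γ hβ one_pos, integral_tilted hw γ hβ (by linarith)]
  have := theta_pos (a := Real.pi * (β ^ 2 + γ ^ 2)) (by positivity)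
  simp only [inv_one, Real.one_rpow, div_one, mul_one]
  field_simp

theorem integrable_exp_neg_mul_sq_norm (n : ℕ) {b : ℝ} (hb : 0 < b) :
    Integrable fun y : E n => Real.exp (-(Real.pi * b) * ‖y‖ ^ 2) :=
  .of_integral_ne_zero (by rw [integral_exp_neg_mul_sq_norm n hb]; positivity)

theorem integral_gaussian_pos (n : ℕ) :
    0 < ∫ y : E n, Real.exp (-(Real.pi * 1) * ‖y‖ ^ 2) := by
  rw [integral_exp_neg_mul_sq_norm n one_pos]; positivity

theorem stdGaussian_eq (n : ℕ) :
    stdGaussian n = ofDensity fun y : E n => Real.exp (-(Real.pi * 1) * ‖y‖ ^ 2) := by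
  simp only [stdGaussian, rho_one]

theorem gaussian_mul_exp (u : ℝ) (y : E n) :
    Real.exp (-(Real.pi * 1) * ‖y‖ ^ 2) * Real.exp (Real.pi * u * ‖y‖ ^ 2) =
      Real.exp (-(Real.pi * (1 - u)) * ‖y‖ ^ 2) := by
  rw [← Real.exp_add]; ring_nf

instance isProbabilityMeasure_stdGaussian (n : ℕ) : IsProbabilityMeasure (stdGaussian n) := by
  rw [stdGaussian_eq]
  exact isProbabilityMeasure_ofDensity (fun _ => (Real.exp_pos _).le)
    (integrable_exp_neg_mul_sq_norm n one_pos) (integral_gaussian_pos n)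

theorem integrable_exp_stdGaussian (n : ℕ) {u : ℝ} (hu : u < 1) :
    Integrable (fun y => Real.exp (Real.pi * u * ‖y‖ ^ 2)) (stdGaussian n) := by
  rw [stdGaussian_eq]
  refine integrable_ofDensity (fun _ => (Real.exp_pos _).le)
    (integrable_exp_neg_mul_sq_norm n one_pos) (integral_gaussian_pos n) ?_
  simp only [gaussian_mul_exp]
  exact integrable_exp_neg_mul_sq_norm n (by linarith)

theorem integral_exp_stdGaussian (n : ℕ) {u : ℝ} (hu : u < 1) :
    ∫ y, Real.exp (Real.pi * u * ‖y‖ ^ 2) ∂(stdGaussian n) = ((1 - u)⁻¹) ^ ((n : ℝ) / 2) := by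
  rw [stdGaussian_eq, integral_ofDensity (fun _ => (Real.exp_pos _).le)
    (integrable_exp_neg_mul_sq_norm n one_pos)]
  simp only [gaussian_mul_exp]
  rw [integral_exp_neg_mul_sq_norm n one_pos, integral_exp_neg_mul_sq_norm n (by linarith)]
  simp

/-! ### The Leibniz series -/

theorem leibniz_eq (k : ℕ) :
    leibniz k = 4 * ∑ i ∈ Finset.range k, (-1 : ℝ) ^ i * (1 / (2 * i + 1)) := by
  rw [leibniz, Finset.mul_sum]
  exact Finset.sum_congr rfl fun i _ => by ring

theorem antitone_one_div_odd : Antitone fun i : ℕ => 1 / (2 * (i : ℝ) + 1) := by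
  intro i j h
  simp only
  gcongr

theorem tendsto_leibniz :
    Tendsto (fun k => ∑ i ∈ Finset.range k, (-1 : ℝ) ^ i * (1 / (2 * i + 1))) atTop
      (𝓝 (Real.pi / 4)) := by
  simpa [div_eq_mul_inv] using Real.tendsto_sum_pi_div_four

/-- Even partial sums of an alternating series with decreasing terms lie below its limit. -/
theorem leibniz_le_pi {T : ℕ} (hT : Even T) : leibniz T ≤ Real.pi := by
  obtain ⟨k, rfl⟩ := even_iff_exists_two_mul.1 hT
  have := antitone_one_div_odd.alternating_series_le_tendsto tendsto_leibniz k
  rw [leibniz_eq]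
  linarith

/-- One more term brings the sum above π, so the error is at most that term, `4 / (2T + 1)`. -/
theorem pi_sub_leibniz_le {T : ℕ} (hT : Even T) : (Real.pi - leibniz T) * (2 * T + 1) ≤ 4 := by
  obtain ⟨k, rfl⟩ := even_iff_exists_two_mul.1 hT
  have := antitone_one_div_odd.tendsto_le_alternating_series tendsto_leibniz k
  rw [Finset.sum_range_succ] at this
  rw [leibniz_eq]
  have h1 : (0 : ℝ) < 2 * ((2 * k : ℕ) : ℝ) + 1 := by positivity
  rw [← le_div_iff₀ h1]
  simp only [pow_mul, neg_one_sq, one_pow, one_mul] at this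
  have h2 : 4 / (2 * ((2 * k : ℕ) : ℝ) + 1) = 4 * (1 / (2 * ((2 * k : ℕ) : ℝ) + 1)) := by ring
  linarith

/-! ### Chernoff bounds for sums of squared norms -/

theorem sum_stream_sq {n : ℕ} (hn : 1 ≤ n) (ω : ℕ → E n) (N : ℕ) :
    ∑ q ∈ Finset.range (n * N), stream ω q * stream ω q = ∑ i ∈ Finset.range N, ‖ω i‖ ^ 2 := by
  induction N with
  | zero => simp
  | succ N ih =>
    rw [mul_add, mul_one, Finset.sum_range_add, ih, Finset.sum_range_succ,
      EuclideanSpace.norm_sq_eq, add_right_inj, Finset.sum_range]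
    refine Finset.sum_congr rfl fun (i : Fin n) _ => ?_
    have h1 : (n * N + i) / n = N := by
      rw [Nat.mul_add_div (by omega), Nat.div_eq_of_lt i.2, add_zero]
    have h2 : (n * N + i) % n = i := by rw [Nat.mul_add_mod, Nat.mod_eq_of_lt i.2]
    have h3 : stream ω (n * N + i) = ω N i := by
      rw [stream, dif_pos (by omega)]
      simp only [h1, h2]
    rw [h3, Real.norm_eq_abs, sq_abs, sq]

section chernoff

variable {n : ℕ} (μ : Measure (E n)) [IsProbabilityMeasure μ] (N : ℕ) {u : ℝ}

theorem iIndepFun_normSq : ProbabilityTheory.iIndepFun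
    (fun (i : ℕ) (ω : ℕ → E n) => Real.pi * ‖ω i‖ ^ 2) (Measure.infinitePi fun _ : ℕ => μ) :=
  ProbabilityTheory.iIndepFun_infinitePi (P := fun _ : ℕ => μ)
    (X := fun _ y => Real.pi * ‖y‖ ^ 2) (fun _ => by fun_prop)

theorem measurePreserving_eval_infinitePi (i : ℕ) :
    MeasurePreserving (fun ω : ℕ → E n => ω i) (Measure.infinitePi fun _ : ℕ => μ) μ :=
  ⟨by fun_prop, Measure.infinitePi_map_eval (fun _ : ℕ => μ) i⟩

variable {μ}

theorem integrable_exp_eval (hi : Integrable (fun y => Real.exp (Real.pi * u * ‖y‖ ^ 2)) μ)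
    (i : ℕ) : Integrable (fun ω : ℕ → E n => Real.exp (u * (Real.pi * ‖ω i‖ ^ 2)))
      (Measure.infinitePi fun _ : ℕ => μ) := by
  have := (measurePreserving_eval_infinitePi μ i).integrable_comp_of_integrable hi
  refine this.congr (ae_of_all _ fun ω => ?_)
  simp only [Function.comp_apply]
  ring_nf

theorem mgf_sum_normSq :
    ProbabilityTheory.mgf (∑ i ∈ Finset.range N, fun ω : ℕ → E n => Real.pi * ‖ω i‖ ^ 2)
      (Measure.infinitePi fun _ : ℕ => μ) u =
    (∫ y, Real.exp (Real.pi * u * ‖y‖ ^ 2) ∂μ) ^ N := by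
  rw [(iIndepFun_normSq μ).mgf_sum (fun _ => by fun_prop)]
  rw [Finset.prod_eq_pow_card (b := ∫ y, Real.exp (Real.pi * u * ‖y‖ ^ 2) ∂μ),
    Finset.card_range]
  intro i _
  rw [ProbabilityTheory.mgf]
  conv_rhs => rw [← (measurePreserving_eval_infinitePi μ i).map_eq]
  rw [integral_map (measurable_pi_apply i).aemeasurable (Measurable.aestronglyMeasurable (by fun_prop))]
  congr 1
  funext ω
  ring_nf

theorem measure_sum_normSq_ge (hu : 0 ≤ u)
    (hi : Integrable (fun y => Real.exp (Real.pi * u * ‖y‖ ^ 2)) μ) (s : ℝ) :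
    (Measure.infinitePi fun _ : ℕ => μ).real
      {ω : ℕ → E n | s ≤ Real.pi * ∑ i ∈ Finset.range N, ‖ω i‖ ^ 2} ≤
    Real.exp (-u * s) * (∫ y, Real.exp (Real.pi * u * ‖y‖ ^ 2) ∂μ) ^ N := by
  have h := ProbabilityTheory.measure_ge_le_exp_mul_mgf s hu
    ((iIndepFun_normSq μ).integrable_exp_mul_sum (s := Finset.range N) (fun _ => by fun_prop)
      fun i _ => integrable_exp_eval hi i)
  rw [mgf_sum_normSq] at h
  simpa [Finset.mul_sum] using h

theorem measure_sum_normSq_le (hu : u ≤ 0)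
    (hi : Integrable (fun y => Real.exp (Real.pi * u * ‖y‖ ^ 2)) μ) (s : ℝ) :
    (Measure.infinitePi fun _ : ℕ => μ).real
      {ω : ℕ → E n | Real.pi * ∑ i ∈ Finset.range N, ‖ω i‖ ^ 2 ≤ s} ≤
    Real.exp (-u * s) * (∫ y, Real.exp (Real.pi * u * ‖y‖ ^ 2) ∂μ) ^ N := by
  have h := ProbabilityTheory.measure_le_le_exp_mul_mgf s hu
    ((iIndepFun_normSq μ).integrable_exp_mul_sum (s := Finset.range N) (fun _ => by fun_prop)
      fun i _ => integrable_exp_eval hi i)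
  rw [mgf_sum_normSq] at h
  simpa [Finset.mul_sum] using h

end chernoff

/-! ### Error probabilities -/

theorem inv_one_add_le_exp {u : ℝ} (hu : 0 ≤ u) : (1 + u)⁻¹ ≤ Real.exp (-u + u ^ 2) := by
  have h := Real.add_one_le_exp (-u + u ^ 2)
  rw [inv_le_iff_one_le_mul₀ (by positivity)]
  -- `(1 + u)(1 - u + u²) = 1 + u³`.
  nlinarith [pow_nonneg hu 3]

theorem inv_one_sub_le_exp {u : ℝ} (hu : 0 ≤ u) (hu' : u ≤ 1 / 2) :
    (1 - u)⁻¹ ≤ Real.exp (u + 2 * u ^ 2) := by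
  have h := Real.add_one_le_exp (u + 2 * u ^ 2)
  rw [inv_le_iff_one_le_mul₀ (by linarith)]
  -- `(1 - u)(1 + u + 2u²) = 1 + u²(1 - 2u)`.
  nlinarith [pow_nonneg hu 2, mul_nonneg (pow_nonneg hu 2) (sub_nonneg.2 hu')]

theorem one_sub_exp_neg_ge {u : ℝ} (hu : 0 ≤ u) (hu' : u ≤ 1) : u / 2 ≤ 1 - Real.exp (-u) := by
  have h := Real.add_one_le_exp u
  have h2 : Real.exp (-u) * Real.exp u = 1 := by rw [← Real.exp_add]; simp
  nlinarith [Real.exp_pos (-u), Real.exp_pos u]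

/-- A lower bound for the relative deviation of the expected squared norm. -/
def gap (γ : ℝ) : ℝ := Real.exp (-(Real.pi * (1 + γ ^ 2))) / (2 * theta Real.pi)

/-- The numerator is `theta (a + c)` with `c ≥ u`. Since `π ≤ a ≤ π(1 + γ²)`, both the drop and the
denominator are bounded independently of `β`. -/
theorem theta_div_le {β γ u : ℝ} (hβ : 0 < β) (hβ1 : β < 1) (hγ : 1 ≤ γ) (hu : 0 ≤ u)
    (hu' : u ≤ 1 / 2) :
    theta (Real.pi * (β ^ 2 + γ ^ 2 / (1 - u))) / theta (Real.pi * (β ^ 2 + γ ^ 2)) ≤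
      Real.exp (-(gap γ * u)) := by
  have hpi := Real.pi_gt_three
  set a := Real.pi * (β ^ 2 + γ ^ 2)
  set c := Real.pi * (γ ^ 2 * (u / (1 - u)))
  have hac : Real.pi * (β ^ 2 + γ ^ 2 / (1 - u)) = a + c := by
    have : (1 - u) ≠ 0 := by linarith
    simp only [a, c]
    field_simp
    ring
  have hγ2 : 1 ≤ γ ^ 2 := one_le_pow₀ hγ
  have hβ2 : β ^ 2 ≤ 1 := pow_le_one₀ hβ.le hβ1.le
  have ha : Real.pi ≤ a := by simp only [a]; nlinarith [sq_nonneg β]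
  have ha0 : 0 < a := by linarith
  have hc : u ≤ c := by
    have h1 : u ≤ u / (1 - u) := by rw [le_div_iff₀ (by linarith)]; nlinarith
    have h2 : u / (1 - u) ≤ γ ^ 2 * (u / (1 - u)) := le_mul_of_one_le_left (by linarith) hγ2
    have h3 : γ ^ 2 * (u / (1 - u)) ≤ c := le_mul_of_one_le_left (by linarith) (by linarith)
    linarith
  have hth := theta_pos ha0
  have hth1 := theta_pos Real.pi_pos
  have hle : theta a ≤ theta Real.pi := theta_antitone Real.pi_pos ha
  have hexp : Real.exp (-(Real.pi * (1 + γ ^ 2))) ≤ Real.exp (-a) := by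
    simp only [a]; gcongr
  have hdec : u / 2 ≤ 1 - Real.exp (-c) :=
    (one_sub_exp_neg_ge hu (by linarith)).trans (by gcongr)
  have hgap : gap γ * u * theta a ≤ Real.exp (-a) * (1 - Real.exp (-c)) := by
    calc gap γ * u * theta a ≤ gap γ * u * theta Real.pi := by
          have : 0 ≤ gap γ := by unfold gap; positivity
          gcongr
      _ = Real.exp (-(Real.pi * (1 + γ ^ 2))) * (u / 2) := by unfold gap; field_simp
      _ ≤ _ := by gcongr
  rw [hac]
  refine le_trans ?_ (Real.one_sub_le_exp_neg _)
  rw [div_le_iff₀ hth]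
  linarith [theta_add_le ha0 (hu.trans hc)]

theorem two_le_two_pow_rounds (a : ℝ) (n : ℕ) : (2 : ℝ) ≤ 2 ^ rounds a n :=
  le_self_pow₀ (by norm_num) (by unfold rounds; positivity)

theorem even_samples (a : ℝ) (n : ℕ) : Even (n * 8 ^ rounds a n) := by
  have : rounds a n ≠ 0 := by unfold rounds; positivity
  exact (Nat.even_pow.2 ⟨by decide, this⟩).mul_left _

theorem eight_pow_eq (k : ℕ) : (8 : ℝ) ^ k = (2 ^ k) ^ 3 := by
  rw [← pow_mul, mul_comm, pow_mul]; norm_num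

/-- The Leibniz sum underestimates π, so replacing it by π loses nothing here. -/
theorem not_accepts_imp {a : ℝ} {n : ℕ} (hn : 1 ≤ n) {ω : ℕ → E n} (h : ¬ Accepts a ω) :
    n * 8 ^ rounds a n / 2 * (1 - 1 / 2 ^ rounds a n) ≤
      Real.pi * ∑ i ∈ Finset.range (8 ^ rounds a n), ‖ω i‖ ^ 2 := by
  rw [Accepts, sum_stream_sq hn, not_lt] at h
  have hA := leibniz_le_pi (even_samples a n)
  have hM := two_le_two_pow_rounds a n
  push_cast at h
  set M : ℝ := 2 ^ rounds a n
  set S := ∑ i ∈ Finset.range (8 ^ rounds a n), ‖ω i‖ ^ 2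
  have hS : 0 ≤ S := Finset.sum_nonneg fun _ _ => by positivity
  have h1 : leibniz (n * 8 ^ rounds a n) * S * 2 * M ≤ Real.pi * S * 2 * M := by gcongr
  have h2 : n * 8 ^ rounds a n / 2 * (1 - 1 / M) =
      (M - 1) * (n * 8 ^ rounds a n) / (2 * M) := by
    field_simp
  rw [h2, div_le_iff₀ (by positivity)]
  linarith

/-- Here the error of the Leibniz sum counts: it shrinks the margin from `1/M` to `1/(2M)`. -/
theorem accepts_imp {a : ℝ} {n : ℕ} (hn : 1 ≤ n) {ω : ℕ → E n} (h : Accepts a ω) :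
    Real.pi * ∑ i ∈ Finset.range (8 ^ rounds a n), ‖ω i‖ ^ 2 ≤
      n * 8 ^ rounds a n / 2 * (1 - 1 / (2 * 2 ^ rounds a n)) := by
  rw [Accepts, sum_stream_sq hn] at h
  have hA := leibniz_le_pi (even_samples a n)
  have hA' := pi_sub_leibniz_le (even_samples a n)
  have hM := two_le_two_pow_rounds a n
  have hpi := Real.pi_gt_three
  have h8 := eight_pow_eq (rounds a n)
  have hn' : (1 : ℝ) ≤ n := by exact_mod_cast hn
  set A := leibniz (n * 8 ^ rounds a n)
  push_cast at h hA'
  set M : ℝ := 2 ^ rounds a n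
  set S := ∑ i ∈ Finset.range (8 ^ rounds a n), ‖ω i‖ ^ 2
  set T : ℝ := n * 8 ^ rounds a n with hT
  have hS : 0 ≤ S := Finset.sum_nonneg fun _ _ => by positivity
  have hTM : 4 * M ≤ T := by
    have h1 : 4 * M ≤ M ^ 3 := by nlinarith [mul_nonneg (sub_nonneg.2 hM) (sub_nonneg.2 hM)]
    have h2 : M ^ 3 ≤ n * M ^ 3 := le_mul_of_one_le_left (by positivity) hn'
    rw [hT, h8]; linarith
  -- Equivalent to `(π - A)(2M - 1) ≤ π`; the Leibniz error bound and `4M ≤ T` give the bound 2.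
  have hB : 2 * Real.pi * (M - 1) ≤ A * (2 * M - 1) := by
    have h1 : (Real.pi - A) * (2 * (2 * M - 1)) ≤ (Real.pi - A) * (2 * T + 1) := by
      apply mul_le_mul_of_nonneg_left <;> linarith
    linarith
  have h1 : Real.pi * S * (4 * M) ≤ (2 * M - 1) * T := by
    have h2 : (M - 1) * (Real.pi * S * (4 * M)) ≤ (M - 1) * ((2 * M - 1) * T) := by
      have h3 := mul_le_mul_of_nonneg_right hB (show 0 ≤ S * (2 * M) by positivity)
      have h4 := mul_le_mul_of_nonneg_right h.le (show 0 ≤ 2 * M - 1 by linarith)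
      nlinarith
    exact le_of_mul_le_mul_left h2 (by linarith)
  have h2 : T / 2 * (1 - 1 / (2 * M)) = (2 * M - 1) * T / (4 * M) := by
    field_simp
    ring
  rw [h2, le_div_iff₀ (by positivity)]
  exact h1

theorem measure_accepts_le (a : ℝ) {n : ℕ} (hn : 1 ≤ n) :
    (Measure.infinitePi fun _ : ℕ => stdGaussian n).real {ω | Accepts a ω} ≤
      Real.exp (-(n / 32)) := by
  have hM := two_le_two_pow_rounds a n
  have h8 := eight_pow_eq (rounds a n)
  set M : ℝ := 2 ^ rounds a n
  set N := 8 ^ rounds a n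
  -- The exponent is at most `(nN/2)(u² - u/(2M))`, minimal at this `u`; as `N = M³`, the minimum is
  -- `-nM/32`.
  set u : ℝ := 1 / (4 * M) with hu
  have hu0 : 0 < u := by positivity
  have h := measure_sum_normSq_le (μ := stdGaussian n) N (u := -u) (by linarith)
    (integrable_exp_stdGaussian n (by linarith)) (n * 8 ^ rounds a n / 2 * (1 - 1 / (2 * M)))
  rw [integral_exp_stdGaussian n (by linarith), sub_neg_eq_add] at h
  refine (measureReal_mono fun ω hω => accepts_imp hn hω).trans (h.trans ?_)
  have h1 : ((1 + u)⁻¹) ^ ((n : ℝ) / 2) ≤ Real.exp ((-u + u ^ 2) * (n / 2)) := by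
    rw [Real.exp_mul]
    exact Real.rpow_le_rpow (by positivity) (inv_one_add_le_exp hu0.le) (by positivity)
  calc _ ≤ Real.exp (- -u * (n * 8 ^ rounds a n / 2 * (1 - 1 / (2 * M)))) *
        Real.exp ((-u + u ^ 2) * (n / 2)) ^ N := by gcongr
    _ = Real.exp (-(n * M / 32)) := by
      rw [← Real.exp_nat_mul, ← Real.exp_add]
      congr 1
      simp only [N]
      push_cast
      rw [h8, hu]
      field_simp
      ring
    _ ≤ _ := by
      have : (n : ℝ) ≤ n * M := le_mul_of_one_le_right (by positivity) (by linarith)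
      gcongr

theorem measure_not_accepts_le (a : ℝ) {n : ℕ} (hn : 1 ≤ n) {w : E n} (hw : ‖w‖ = 1) {β γ : ℝ}
    (hβ : 0 < β) (hβ1 : β < 1) (hγ : 1 ≤ γ) (hgap : 2 * n ≤ gap γ * 2 ^ rounds a n) :
    (Measure.infinitePi fun _ : ℕ => homCLWE w β γ).real {ω | ¬ Accepts a ω} ≤
      Real.exp (-(n / 2)) := by
  have := isProbabilityMeasure_homCLWE hw γ hβ
  have hM := two_le_two_pow_rounds a n
  have h8 := eight_pow_eq (rounds a n)
  set M : ℝ := 2 ^ rounds a n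
  set N := 8 ^ rounds a n
  -- With `N = M³` this makes the second-order terms `3nM/2` and the theta gain `gap γ * M²`, which
  -- `hgap` bounds below by `2nM`.
  set u : ℝ := 1 / M with hu
  have hu0 : 0 < u := by positivity
  have hu1 : u ≤ 1 / 2 := by rw [hu]; gcongr
  have h := measure_sum_normSq_ge (μ := homCLWE w β γ) N (u := u) hu0.le
    (integrable_exp_homCLWE hw γ hβ (by linarith)) (n * 8 ^ rounds a n / 2 * (1 - 1 / M))
  rw [integral_exp_homCLWE hw γ hβ (by linarith)] at h
  refine (measureReal_mono fun ω hω => not_accepts_imp hn hω).trans (h.trans ?_)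
  have h1 : ((1 - u)⁻¹) ^ ((n : ℝ) / 2) ≤ Real.exp ((u + 2 * u ^ 2) * (n / 2)) := by
    rw [Real.exp_mul]
    exact Real.rpow_le_rpow (inv_nonneg.2 (by linarith)) (inv_one_sub_le_exp hu0.le hu1)
      (by positivity)
  have h2 := theta_div_le hβ hβ1 hγ hu0.le hu1
  have h0 : 0 ≤ theta (Real.pi * (β ^ 2 + γ ^ 2 / (1 - u))) / theta (Real.pi * (β ^ 2 + γ ^ 2)) :=
    div_nonneg (tsum_nonneg fun _ => (Real.exp_pos _).le)
      (tsum_nonneg fun _ => (Real.exp_pos _).le)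
  have h3 : 0 ≤ ((1 - u)⁻¹) ^ ((n : ℝ) / 2) := Real.rpow_nonneg (inv_nonneg.2 (by linarith)) _
  calc _ ≤ Real.exp (-u * (n * 8 ^ rounds a n / 2 * (1 - 1 / M))) *
        (Real.exp ((u + 2 * u ^ 2) * (n / 2)) * Real.exp (-(gap γ * u))) ^ N := by gcongr
    _ = Real.exp (3 / 2 * (n * M) - gap γ * M * M) := by
      rw [← Real.exp_add, ← Real.exp_nat_mul, ← Real.exp_add]
      congr 1
      simp only [N]
      push_cast
      rw [h8, hu]
      field_simp
      ring
    _ ≤ _ := by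
      have : (n : ℝ) ≤ n * M := le_mul_of_one_le_right (by positivity) (by linarith)
      have h4 := mul_le_mul_of_nonneg_right hgap (show 0 ≤ M by linarith)
      apply Real.exp_le_exp.2
      linarith

/-! ### Size of the parameters -/

section rounds

variable {ε : ℝ} {n : ℕ}

/-- Rounding up and subtracting one loses at most a factor 2 from the 16 in `rounds`. -/
theorem rpow_le_rounds (hε : 0 < ε) (hn : 1 ≤ n) : 8 * (n : ℝ) ^ (2 * ε) ≤ rounds ε n := by
  set r := (Nat.clog 2 n : ℝ) * (ε + ε) with hr
  have h1 : r - 1 ≤ ((⌈r⌉₊ - 1 : ℕ) : ℝ) := by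
    have h2 := Nat.le_ceil r
    have h3 : ((⌈r⌉₊ : ℕ) : ℝ) ≤ ((⌈r⌉₊ - 1 : ℕ) : ℝ) + 1 := by
      exact_mod_cast (by omega : ⌈r⌉₊ ≤ ⌈r⌉₊ - 1 + 1)
    linarith
  have h2 : (n : ℝ) ≤ 2 ^ Nat.clog 2 n := by exact_mod_cast Nat.le_pow_clog one_lt_two n
  have h3 : (n : ℝ) ^ (2 * ε) ≤ (2 : ℝ) ^ r := by
    calc (n : ℝ) ^ (2 * ε) ≤ ((2 : ℝ) ^ Nat.clog 2 n) ^ (2 * ε) := by gcongr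
      _ = 2 ^ r := by rw [← Real.rpow_natCast, ← Real.rpow_mul zero_le_two, hr]; ring_nf
  have h4 : (2 : ℝ) ^ (r - 1) ≤ 2 ^ (⌈r⌉₊ - 1) := by
    rw [← Real.rpow_natCast]
    exact Real.rpow_le_rpow_of_exponent_le one_le_two h1
  rw [Real.rpow_sub_one two_ne_zero] at h4
  rw [rounds]
  push_cast
  linarith

theorem rounds_le_rpow (hε : 0 < ε) (hε' : ε < 1 / 2) (hn : 1 ≤ n) :
    (rounds ε n : ℝ) ≤ 32 * (n : ℝ) ^ (2 * ε) := by
  set r := (Nat.clog 2 n : ℝ) * (ε + ε) with hr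
  have hr0 : 0 ≤ r := by positivity
  have h1 : ((⌈r⌉₊ - 1 : ℕ) : ℝ) ≤ r := by
    rcases Nat.eq_zero_or_pos ⌈r⌉₊ with h | h
    · rw [h]; simpa using hr0
    · have := Nat.ceil_lt_add_one hr0
      rw [Nat.cast_sub h]; push_cast; linarith
  have h2 : (2 : ℝ) ^ Nat.clog 2 n ≤ 2 * n := by
    have : 2 ^ Nat.clog 2 n ≤ 2 * n := by
      rcases Nat.eq_zero_or_pos (Nat.clog 2 n) with h | h
      · rw [h]; omega
      · obtain ⟨k, hk⟩ := Nat.exists_eq_add_of_lt h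
        have := (Nat.lt_clog_iff_pow_lt one_lt_two (x := n) (y := k)).1 (by omega)
        rw [hk, zero_add, pow_succ]; omega
    exact_mod_cast this
  -- The factor 2 comes from `2^clog ≤ 2n`, because the exponent `2ε` is below 1.
  have h3 : (2 : ℝ) ^ r ≤ 2 * (n : ℝ) ^ (2 * ε) := by
    calc (2 : ℝ) ^ r = ((2 : ℝ) ^ Nat.clog 2 n) ^ (2 * ε) := by
          rw [← Real.rpow_natCast, ← Real.rpow_mul zero_le_two, hr]; ring_nf
      _ ≤ (2 * n) ^ (2 * ε) := by gcongr
      _ = 2 ^ (2 * ε) * (n : ℝ) ^ (2 * ε) := Real.mul_rpow zero_le_two (by positivity)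
      _ ≤ 2 ^ (1 : ℝ) * (n : ℝ) ^ (2 * ε) := by
          gcongr
          · exact one_le_two
          · linarith
      _ = _ := by rw [Real.rpow_one]
  have h4 : (2 : ℝ) ^ (⌈r⌉₊ - 1) ≤ 2 ^ r := by
    rw [← Real.rpow_natCast]
    exact Real.rpow_le_rpow_of_exponent_le one_le_two h1
  rw [rounds]
  push_cast
  linarith

theorem runsInTime_prog (hε : 0 < ε) (hε' : ε < 1 / 2) :
    RunsInTime prog ε
      (fun n => Real.exp ((51 + 1 / (2 * ε) + 32 * Real.log 8) * (n : ℝ) ^ (2 * ε))) := by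
  classical
  intro n hn ω
  obtain ⟨t, ht, hout⟩ := exists_run_out ε hn ω
  refine ⟨t, ?_, _, hout⟩
  have hn' : (1 : ℝ) ≤ n := by exact_mod_cast hn
  set x := (n : ℝ) ^ (2 * ε)
  have hx : 1 ≤ x := Real.one_le_rpow hn' (by positivity)
  -- From `log n ≤ n^(2ε) / (2ε)`; this lets the exponential absorb the polynomial factor.
  have h1 : (n : ℝ) ≤ Real.exp (1 / (2 * ε) * x) := by
    rw [← Real.log_le_iff_le_exp (by positivity)]
    have := Real.log_le_rpow_div (x := (n : ℝ)) (by positivity) (show 0 < 2 * ε by positivity)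
    rw [one_div_mul_eq_div]; exact this
  have h2 : (8 : ℝ) ^ rounds ε n ≤ Real.exp (32 * Real.log 8 * x) := by
    rw [← Real.exp_log (show (0 : ℝ) < 8 by norm_num), ← Real.exp_nat_mul,
      Real.exp_log (by norm_num)]
    have h3 := rounds_le_rpow hε hε' hn
    have h4 : 0 < Real.log 8 := Real.log_pos (by norm_num)
    apply Real.exp_le_exp.2
    nlinarith
  have h3 : (51 : ℝ) ≤ Real.exp (51 * x) := by
    have := Real.add_one_le_exp (51 * x)
    linarith
  calc (t : ℝ) ≤ 51 * (n * 8 ^ rounds ε n) := by exact_mod_cast ht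
    _ ≤ Real.exp (51 * x) * (Real.exp (1 / (2 * ε) * x) * Real.exp (32 * Real.log 8 * x)) := by
      gcongr
    _ = Real.exp ((51 + 1 / (2 * ε) + 32 * Real.log 8) * x) := by
      rw [← Real.exp_add, ← Real.exp_add]
      ring_nf

theorem eventually_le_gap (hε : 0 < ε) :
    ∀ᶠ n : ℕ in atTop, 2 * (n : ℝ) ≤ gap ((n : ℝ) ^ ε) * 2 ^ rounds ε n := by
  have hth := theta_pos Real.pi_pos
  -- Collects every factor free of `n` in `2n / gap`, leaving `exp(πx) * K * n` to be bounded.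
  set K : ℝ := 4 * theta Real.pi * Real.exp Real.pi with hK
  have hlim : Tendsto (fun n : ℕ => (n : ℝ) ^ (2 * ε)) atTop atTop :=
    (tendsto_rpow_atTop (by positivity)).comp tendsto_natCast_atTop_atTop
  have h0 := ((tendsto_rpow_mul_exp_neg_mul_atTop_nhds_zero (1 / (2 * ε)) 1 one_pos).comp
    hlim).eventually (gt_mem_nhds (show (0 : ℝ) < 1 / K by positivity))
  filter_upwards [h0, eventually_ge_atTop 1] with n h hn
  set x := (n : ℝ) ^ (2 * ε) with hx
  have hnx : x ^ (1 / (2 * ε)) = n := by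
    rw [hx, ← Real.rpow_mul (by positivity), mul_one_div_cancel (by positivity), Real.rpow_one]
  have hgx : ((n : ℝ) ^ ε) ^ 2 = x := by
    rw [hx, ← Real.rpow_natCast, ← Real.rpow_mul (by positivity)]
    push_cast
    ring_nf
  have hx0 : 0 ≤ x := by positivity
  simp only [Function.comp_apply, neg_mul, one_mul] at h
  rw [← hx, hnx] at h
  have h1 : K * n ≤ Real.exp x := by
    rw [Real.exp_neg, ← div_eq_mul_inv, div_lt_div_iff₀ (Real.exp_pos _) (by positivity)] at h
    linarith
  -- `8 log 2 > 5`. Of the exponent `5x`, `4x` pays for `πx` and the remaining `x` for `K * n`.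
  have h2 : Real.exp (5 * x) ≤ 2 ^ rounds ε n := by
    have h3 := rpow_le_rounds hε hn
    have h4 := Real.log_two_gt_d9
    rw [← Real.exp_log (show (0 : ℝ) < 2 by norm_num), ← Real.exp_nat_mul]
    apply Real.exp_le_exp.2
    nlinarith
  have h5 : Real.exp (Real.pi * x) ≤ Real.exp (4 * x) := by
    have := Real.pi_lt_four
    gcongr
  have h6 : Real.exp (5 * x) = Real.exp (4 * x) * Real.exp x := by
    rw [← Real.exp_add]; ring_nf
  have h7 : Real.exp (-(Real.pi * (1 + x))) =
      (Real.exp Real.pi)⁻¹ * (Real.exp (Real.pi * x))⁻¹ := by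
    rw [← Real.exp_neg, ← Real.exp_neg, ← Real.exp_add]; ring_nf
  have h8 : Real.exp (Real.pi * x) * (K * n) ≤ 2 ^ rounds ε n := by
    calc _ ≤ Real.exp (4 * x) * Real.exp x := by gcongr
      _ ≤ _ := h6 ▸ h2
  calc 2 * (n : ℝ) = (Real.exp Real.pi)⁻¹ * (Real.exp (Real.pi * x))⁻¹ / (2 * theta Real.pi) *
        (Real.exp (Real.pi * x) * (K * n)) := by
        rw [hK]; field_simp; norm_num
    _ ≤ _ := by rw [gap, hgx, h7]; gcongr

end rounds

/-! ### The decision problem -/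

theorem isProbabilityMeasure_uniformSphere {n : ℕ} (hn : 1 ≤ n) :
    IsProbabilityMeasure (uniformSphere n) := by
  have : Nonempty (Fin n) := ⟨⟨0, hn⟩⟩
  constructor
  rw [uniformSphere, Measure.smul_apply, smul_eq_mul]
  refine ENNReal.inv_mul_cancel ?_ (measure_ne_top _ _)
  rw [Ne, Measure.measure_univ_eq_zero, Measure.toSphere_eq_zero_iff]
  exact not_subsingleton _

/-- Subadditivity of the outer measure suffices, so the acceptance event need not be shown
measurable. -/
theorem one_sub_le_measure_compl {α : Type*} {mα : MeasurableSpace α} (μ : Measure α)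
    [IsProbabilityMeasure μ] (s : Set α) {δ : ℝ} (h : μ.real s ≤ δ) :
    1 - ENNReal.ofReal δ ≤ μ sᶜ := by
  have h1 : μ s ≤ ENNReal.ofReal δ := by
    rw [← ofReal_measureReal]; exact ENNReal.ofReal_le_ofReal h
  have h2 : (1 : ℝ≥0∞) ≤ μ s + μ sᶜ := by
    rw [← measure_univ (μ := μ), ← Set.union_compl_self s]; exact measure_union_le _ _
  exact tsub_le_iff_left.2 (h2.trans (by gcongr))

theorem tendsto_one_sub_ofReal_exp {c : ℝ} (hc : 0 < c) :
    Tendsto (fun n : ℕ => 1 - ENNReal.ofReal (Real.exp (-(n / c)))) atTop (𝓝 1) := by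
  have h1 : Tendsto (fun n : ℕ => Real.exp (-((n : ℝ) / c))) atTop (𝓝 0) :=
    Real.tendsto_exp_neg_atTop_nhds_zero.comp
      (tendsto_natCast_atTop_atTop.atTop_div_const hc)
  have h2 := ENNReal.Tendsto.sub (tendsto_const_nhds (x := (1 : ℝ≥0∞)))
    (ENNReal.tendsto_ofReal h1) (Or.inl ENNReal.one_ne_top)
  simpa using h2

theorem tendsto_answerProb_stdGaussian (ε : ℝ) :
    Tendsto (fun n => answerProb prog ε (stdGaussian n) false) atTop (𝓝 1) := by
  refine tendsto_of_tendsto_of_tendsto_of_le_of_le' (tendsto_one_sub_ofReal_exp (c := 32)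
    (by norm_num)) tendsto_const_nhds ?_ (Eventually.of_forall fun n => prob_le_one)
  filter_upwards [eventually_ge_atTop 1] with n hn
  exact (one_sub_le_measure_compl _ _ (measure_accepts_le ε hn)).trans
    (measure_mono fun ω hω => answers_false hn hω)

theorem tendsto_answerProbHomCLWE {ε : ℝ} (hε : 0 < ε) {β : ℕ → ℝ}
    (hβ : ∀ n, 0 < β n ∧ β n < 1) :
    Tendsto (fun n => answerProbHomCLWE prog ε n (β n) ((n : ℝ) ^ ε) true) atTop (𝓝 1) := by
  refine tendsto_of_tendsto_of_tendsto_of_le_of_le' (tendsto_one_sub_ofReal_exp (c := 2)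
    (by norm_num)) tendsto_const_nhds ?_ ?_
  · filter_upwards [eventually_ge_atTop 1, eventually_le_gap hε] with n hn hgap
    have := isProbabilityMeasure_uniformSphere hn
    have hγ : 1 ≤ (n : ℝ) ^ ε := Real.one_le_rpow (by exact_mod_cast hn) hε.le
    calc 1 - ENNReal.ofReal (Real.exp (-(n / 2)))
        = ∫⁻ _, (1 - ENNReal.ofReal (Real.exp (-(n / 2)))) ∂(uniformSphere n) := by simp
      _ ≤ _ := by
        -- The error bound is uniform in `w`, so no measurability in `w` is needed.
        refine lintegral_mono fun w => ?_
        have hw : ‖(w : E n)‖ = 1 := norm_eq_of_mem_sphere w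
        have := isProbabilityMeasure_homCLWE hw ((n : ℝ) ^ ε) (hβ n).1
        refine (one_sub_le_measure_compl _ _
          (measure_not_accepts_le ε hn hw (hβ n).1 (hβ n).2 hγ hgap)).trans
          (measure_mono fun ω hω => answers_true hn ?_)
        simpa using hω
  · filter_upwards [eventually_ge_atTop 1] with n hn
    have := isProbabilityMeasure_uniformSphere hn
    calc answerProbHomCLWE prog ε n (β n) ((n : ℝ) ^ ε) true
        ≤ ∫⁻ _, 1 ∂(uniformSphere n) := by
          refine lintegral_mono fun w => ?_
          have := isProbabilityMeasure_homCLWE (norm_eq_of_mem_sphere w) ((n : ℝ) ^ ε) (hβ n).1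
          exact prob_le_one
      _ = 1 := by simp

end HCLWE

end

theorem mainTheorem7 (ε : ℝ) (hε0 : 0 < ε) (hε : ε < 1 / 2)
    (β : ℕ → ℝ) (hβ : ∀ n : ℕ, 0 < β n ∧ β n < 1) :
    ∃ P : HCLWE.Program,
      (∃ C : ℝ, HCLWE.RunsInTime P ε (fun n => Real.exp (C * (n : ℝ) ^ (2 * ε)))) ∧
      HCLWE.SolvesHCLWE P ε β (fun n => (n : ℝ) ^ ε) :=
  ⟨HCLWE.prog, ⟨_, HCLWE.runsInTime_prog hε0 hε⟩, HCLWE.tendsto_answerProbHomCLWE hε0 hβ,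
    HCLWE.tendsto_answerProb_stdGaussian ε⟩
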